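/- Let $G$ be a finite planar Tanner graph, that is, a finite bipartite simple graph with $n\ge 1$ bit nodes on one side and $m$ check nodes on the other that can be drawn in the plane with no two edges intersecting except at common ends. Let every bit node of $G$ have degree at most $3$. Let $\mathcal{K}\subseteq\mathbb{F}_2^n$ be the binary linear code defined by $G$: the set of all $x\in\mathbb{F}_2^n$ such that, for every check node $c$, the sum of the $x_b$ over the bit nodes $b$ adjacent to $c$ is $0$. If $R=1-m/n\ge 7/8$, then the minimum distance $d$ of $\mathcal{K}$, the least Hamming distance between two different codewords, satisfies $d\le 3$ (in particular, $\mathcal{K}$ has at least two codewords). -/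

import Mathlib

/-- A drawing of a simple graph in the Euclidean plane in which edges meet only at their ends:
distinct vertices are distinct points, every edge is a simple continuous arc joining the points of
its two ends and passing through no other vertex, and two different edges share no point other
than a vertex. -/
structure PlaneEmbedding {V : Type*} (G : SimpleGraph V) where
  /-- the location of each vertex -/
  point : V → EuclideanSpace ℝ (Fin 2)
  /-- the curve that draws each edge -/
  arc : G.edgeSet → unitInterval → EuclideanSpace ℝ (Fin 2)
  point_injective : Function.Injective point
  arc_continuous : ∀ e, Continuous (arc e)
  arc_injective : ∀ e, Function.Injective (arc e)
  arc_ends : ∀ e, s(arc e 0, arc e 1) = Sym2.map point (e : Sym2 V)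
  arc_interior : ∀ e t, t ≠ 0 → t ≠ 1 → arc e t ∉ Set.range point
  arc_inter : ∀ e f, e ≠ f → ∀ s t, arc e s = arc f t → arc e s ∈ Set.range point

/-- A graph is planar if it can be drawn in the plane with no two edges intersecting, except at
common ends. -/
def IsPlanarGraph {V : Type*} (G : SimpleGraph V) : Prop :=
  Nonempty (PlaneEmbedding G)

/-- A Tanner graph with bit nodes `B` and check nodes `C`: a bipartite graph, given by the set of
pairs (bit node, check node) that are joined by an edge. -/
structure TannerGraph (B C : Type*) where
  /-- `Adj b c` says that the bit node `b` and the check node `c` are joined by an edge -/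
  Adj : B → C → Prop

namespace TannerGraph

variable {B C : Type*}

/-- The underlying simple graph, on the disjoint union of the bit nodes and the check nodes. -/
def toSimpleGraph (G : TannerGraph B C) : SimpleGraph (B ⊕ C) where
  Adj
    | .inl b, .inr c => G.Adj b c
    | .inr c, .inl b => G.Adj b c
    | _, _ => False
  symm := ⟨by rintro (b | c) (b' | c') h <;> exact h⟩
  loopless := ⟨by rintro (b | c) h <;> exact h⟩

/-- A Tanner graph is planar if its underlying graph is. -/
def IsPlanar (G : TannerGraph B C) : Prop :=
  IsPlanarGraph G.toSimpleGraph

open Classical in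
/-- The set of check nodes that are joined to the bit node `b`. -/
noncomputable def bitNeighbors [Fintype C] (G : TannerGraph B C) (b : B) : Finset C :=
  {c | G.Adj b c}

/-- The degree of a bit node. -/
noncomputable def bitDegree [Fintype C] (G : TannerGraph B C) (b : B) : ℕ :=
  (G.bitNeighbors b).card

open Classical in
/-- The binary parity-check matrix: one row for each check node, one column for each bit node. -/
noncomputable def parityCheck (G : TannerGraph B C) : Matrix C B (ZMod 2) :=
  Matrix.of fun c b => if G.Adj b c then 1 else 0

/-- The binary linear code defined by a Tanner graph: the words that satisfy all parity checks. -/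
noncomputable def code [Fintype B] (G : TannerGraph B C) : Submodule (ZMod 2) (B → ZMod 2) :=
  LinearMap.ker G.parityCheck.mulVecLin

end TannerGraph

/-- The minimum distance of a binary linear code, the least Hamming distance between two different
codewords; it is `⊤` for the code that has the zero word only. -/
noncomputable def codeMinDist {B : Type*} [Fintype B] (K : Submodule (ZMod 2) (B → ZMod 2)) : ℕ∞ :=
  ⨅ (x ∈ K) (y ∈ K) (_ : x ≠ y), (hammingDist x y : ℕ∞)

/-! A bit without neighbours gives a codeword of weight 1, and two bits with equal neighbourhoods
give one of weight 2. Otherwise the neighbourhoods are n distinct nonempty sets of at most three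
checks, each a clique of `shadow`. The contradiction is that `shadow`, on m vertices, has fewer than
8m such cliques: m points, at most 3m - 3 edges and at most 4m - 4 triangles (`card_cliques_lt`).

`shadow` is drawn by routing its edges through bits. Edges with a common end may then overlap, but
edges without one stay disjoint, since four checks cannot share a bit. This weak planarity survives
edge contraction (`IsWeaklyPlanar.mergeVertex`) and excludes K₅ by a parity count of winding numbers
(`not_disjoint_curves_five`). Nothing more is needed for Mader's edge bound
(`card_edgeFinset_add_three_le`). -/

/-! ### Winding numbers and the non-planarity of K₅ -/

theorem exists_continuous_log {A : Type*} [TopologicalSpace A] [SimplyConnectedSpace A]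
    [LocallyPathConnectedSpace A] {f : A → ℂ} (hf : Continuous f) (h0 : ∀ a, f a ≠ 0) :
    ∃ g : A → ℂ, Continuous g ∧ ∀ a, Complex.exp (g a) = f a := by
  obtain ⟨a₀⟩ : Nonempty A := inferInstance
  obtain ⟨g, ⟨-, hg⟩, -⟩ := Complex.isCoveringMapOn_exp.existsUnique_continuousMap_lifts
    ⟨f, hf⟩ (a₀ := a₀) (Complex.exp_log (h0 a₀)) h0
  exact ⟨g, g.continuous, fun a => congrFun hg a⟩

theorem sub_eq_sub_of_exp_eq {A : Type*} [TopologicalSpace A] [PreconnectedSpace A] {g h : A → ℂ}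
    (hg : Continuous g) (hh : Continuous h) (H : ∀ a, Complex.exp (g a) = Complex.exp (h a))
    (a b : A) : g b - g a = h b - h a := by
  have key : g = fun x => h x + (g a - h a) := by
    refine Complex.isCoveringMap_exp.eq_of_comp_eq hg (by fun_prop) ?_ a (by simp)
    funext x
    apply Subtype.ext
    simp [Complex.exp_add, Complex.exp_sub, H, Complex.exp_ne_zero]
  have := congrFun key b
  rw [this]; ring

/-- Going around the parameter square of two disjoint curves, the changes of the logarithm of
their difference along the four sides cancel. -/
theorem log_change_square {f g : ℝ → ℂ} (hf : Continuous f) (hg : Continuous g)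
    (hfg : ∀ s t, f s ≠ g t) {u₀ u₁ v₀ v₁ : ℝ → ℂ} (hu₀ : Continuous u₀) (hu₁ : Continuous u₁)
    (hv₀ : Continuous v₀) (hv₁ : Continuous v₁)
    (eu₀ : ∀ t, Complex.exp (u₀ t) = f t - g 0) (eu₁ : ∀ t, Complex.exp (u₁ t) = f t - g 1)
    (ev₀ : ∀ t, Complex.exp (v₀ t) = g t - f 0) (ev₁ : ∀ t, Complex.exp (v₁ t) = g t - f 1) :
    (u₀ 1 - u₀ 0) + (v₁ 1 - v₁ 0) = (v₀ 1 - v₀ 0) + (u₁ 1 - u₁ 0) := by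
  -- The parameter plane is simply connected, so one logarithm of f s - g t serves all four sides;
  -- the shift by πi accounts for the sign of g - f.
  obtain ⟨l, hl, el⟩ := exists_continuous_log (A := ℝ × ℝ) (f := fun x => f x.1 - g x.2)
    (by fun_prop) (fun x => sub_ne_zero.2 (hfg _ _))
  have neg (z : ℂ) : Complex.exp (z + Real.pi * Complex.I) = - Complex.exp z := by
    rw [Complex.exp_add, Complex.exp_pi_mul_I]; ring
  have h1 := sub_eq_sub_of_exp_eq hu₀ (h := fun t => l (t, 0)) (by fun_prop)
    (fun t => by rw [eu₀, el]) 0 1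
  have h2 := sub_eq_sub_of_exp_eq hu₁ (h := fun t => l (t, 1)) (by fun_prop)
    (fun t => by rw [eu₁, el]) 0 1
  have h3 := sub_eq_sub_of_exp_eq hv₀ (h := fun t => l (0, t) + Real.pi * Complex.I) (by fun_prop)
    (fun t => by rw [ev₀, neg, el]; ring) 0 1
  have h4 := sub_eq_sub_of_exp_eq hv₁ (h := fun t => l (1, t) + Real.pi * Complex.I) (by fun_prop)
    (fun t => by rw [ev₁, neg, el]; ring) 0 1
  rw [h1, h2, h3, h4]; ring

/-- Five points cannot be joined pairwise by curves in the plane such that curves without a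
common end are disjoint. -/
theorem not_disjoint_curves_five (p : Fin 5 → ℂ) (γ : Fin 5 → Fin 5 → ℝ → ℂ)
    (hc : ∀ a b, a ≠ b → Continuous (γ a b)) (h0 : ∀ a b, a ≠ b → γ a b 0 = p a)
    (h1 : ∀ a b, a ≠ b → γ a b 1 = p b)
    (hd : ∀ a b c d, a ≠ b → c ≠ d → a ≠ c → a ≠ d → b ≠ c → b ≠ d → ∀ s t, γ a b s ≠ γ c d t) :
    False := by
  have exfour : ∀ a b c : Fin 5, ∃ d, d ≠ a ∧ d ≠ b ∧ d ≠ c := by decide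
  have hp : ∀ c a b t, a ≠ b → c ≠ a → c ≠ b → γ a b t ≠ p c := by
    intro c a b t hab hca hcb
    -- The curve from c to a fourth vertex d starts at p c and has no end in common with ab.
    obtain ⟨d, h⟩ := exfour a b c
    rw [← h0 c d h.2.2.symm]
    exact hd a b c d hab h.2.2.symm hca.symm h.1.symm hcb.symm h.2.1.symm t 0
  have hpp : ∀ a b, a ≠ b → p a ≠ p b := by
    intro a b hab
    obtain ⟨d, h⟩ := exfour a b a
    rw [← h0 a d h.1.symm]
    exact hp b a d 0 h.1.symm hab.symm h.2.1.symm
  -- Reference logarithms of p b - p c, chosen so that swapping b and c changes them by exactly ±πi.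
  -- The integer N c a b below counts the turns of the curve ab around p c relative to them.
  let θ : Fin 5 → Fin 5 → ℂ := fun c b =>
    if c < b then Complex.log (p b - p c) else Complex.log (p c - p b) + Real.pi * Complex.I
  let σ : Fin 5 → Fin 5 → ℤ := fun c b => if c < b then -1 else 1
  have eθ : ∀ c b, c ≠ b → Complex.exp (θ c b) = p b - p c := by
    intro c b hcb
    simp only [θ]
    split_ifs with h
    · rw [Complex.exp_log (sub_ne_zero.2 (hpp _ _ hcb.symm))]
    · rw [Complex.exp_add, Complex.exp_pi_mul_I, Complex.exp_log (sub_ne_zero.2 (hpp _ _ hcb))]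
      ring
  have hσ : ∀ c b, c ≠ b → θ c b - θ b c = σ c b * (Real.pi * Complex.I) := by
    intro c b hcb
    simp only [θ, σ]
    rcases lt_or_gt_of_ne hcb with h | h
    · simp [h, h.not_gt]
    · simp [h, h.not_gt]
  have exN : ∀ c a b, ∃ (N : ℤ) (l : ℝ → ℂ), a ≠ b → c ≠ a → c ≠ b → Continuous l ∧
      (∀ t, Complex.exp (l t) = γ a b t - p c) ∧
      l 1 - l 0 = θ c b - θ c a + N * (2 * Real.pi * Complex.I) := by
    intro c a b
    by_cases h : a ≠ b ∧ c ≠ a ∧ c ≠ b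
    · obtain ⟨hab, hca, hcb⟩ := h
      have := hc a b hab
      obtain ⟨l, hl, el⟩ := exists_continuous_log (f := fun t => γ a b t - p c) (by fun_prop)
        (fun t => sub_ne_zero.2 (hp c a b t hab hca hcb))
      have e1 : Complex.exp (l 1) = Complex.exp (θ c b) := by rw [el, eθ c b hcb, h1 a b hab]
      have e0 : Complex.exp (l 0) = Complex.exp (θ c a) := by rw [el, eθ c a hca, h0 a b hab]
      obtain ⟨n, hn⟩ := Complex.exp_eq_exp_iff_exists_int.1 e1
      obtain ⟨k, hk⟩ := Complex.exp_eq_exp_iff_exists_int.1 e0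
      refine ⟨n - k, l, fun _ _ _ => ⟨hl, el, ?_⟩⟩
      rw [hn, hk]; push_cast; ring
    · exact ⟨0, 0, fun h1 h2 h3 => absurd ⟨h1, h2, h3⟩ h⟩
  choose N l hl using exN
  have rel : ∀ a b c d, a ≠ b → c ≠ d → a ≠ c → a ≠ d → b ≠ c → b ≠ d →
      σ c b + σ a c + σ b d + σ d a + 2 * (N c a b + N b c d - N a c d - N d a b) = 0 := by
    intro a b c d hab hcd hac had hbc hbd
    obtain ⟨c1, e1, d1⟩ := hl c a b hab hac.symm hbc.symm
    obtain ⟨c2, e2, d2⟩ := hl b c d hcd hbc hbd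
    obtain ⟨c3, e3, d3⟩ := hl a c d hcd hac had
    obtain ⟨c4, e4, d4⟩ := hl d a b hab had.symm hbd.symm
    have sq := log_change_square (hc a b hab) (hc c d hcd) (hd a b c d hab hcd hac had hbc hbd)
      c1 c4 c3 c2 (by rwa [h0 c d hcd]) (by rwa [h1 c d hcd]) (by rwa [h0 a b hab])
      (by rwa [h1 a b hab])
    rw [d1, d2, d3, d4] at sq
    have s1 := hσ c b hbc.symm
    have s2 := hσ a c hac
    have s3 := hσ b d hbd
    have s4 := hσ d a had.symm
    have hπ : (Real.pi * Complex.I : ℂ) ≠ 0 :=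
      mul_ne_zero (by exact_mod_cast Real.pi_ne_zero) Complex.I_ne_zero
    have : ((σ c b + σ a c + σ b d + σ d a +
        2 * (N c a b + N b c d - N a c d - N d a b) : ℤ) : ℂ) * (Real.pi * Complex.I) = 0 := by
      push_cast
      linear_combination sq - s1 - s2 - s3 - s4
    exact_mod_cast (mul_eq_zero.1 this).resolve_right hπ
  -- Halve and add the relations of the 15 disjoint pairs of edges. Each N occurs in two of them, so
  -- the N part is even. The half-sum of the σ is odd exactly for interleaved pairs a < c < b < d,
  -- one for each of the five 4-subsets, so the total is odd.
  have r01 := rel 0 1 2 3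
  have r02 := rel 0 1 2 4
  have r03 := rel 0 1 3 4
  have r04 := rel 0 2 1 3
  have r05 := rel 0 2 1 4
  have r06 := rel 0 2 3 4
  have r07 := rel 0 3 1 2
  have r08 := rel 0 3 1 4
  have r09 := rel 0 3 2 4
  have r10 := rel 0 4 1 2
  have r11 := rel 0 4 1 3
  have r12 := rel 0 4 2 3
  have r13 := rel 1 2 3 4
  have r14 := rel 1 3 2 4
  have r15 := rel 1 4 2 3
  simp [σ] at r01 r02 r03 r04 r05 r06 r07 r08 r09 r10 r11 r12 r13 r14 r15
  omega

/-! ### Weak planarity and edge contraction -/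

/-- A graph is weakly planar if its edges can be drawn as connecting sets in the plane such that
edges without a common end are drawn disjointly. -/
def IsWeaklyPlanar {V : Type*} (G : SimpleGraph V) : Prop :=
  ∃ (p : V → ℂ) (K : V → V → Set ℂ), (∀ a b, G.Adj a b → JoinedIn (K a b) (p a) (p b)) ∧
    ∀ a b c d, G.Adj a b → G.Adj c d → a ≠ c → a ≠ d → b ≠ c → b ≠ d → Disjoint (K a b) (K c d)

namespace IsWeaklyPlanar

variable {V : Type*} {G H : SimpleGraph V}

theorem mono (hG : IsWeaklyPlanar G) (h : H ≤ G) : IsWeaklyPlanar H := by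
  obtain ⟨p, K, h1, h2⟩ := hG
  exact ⟨p, K, fun a b hab => h1 a b (h hab),
    fun a b c d hab hcd => h2 a b c d (h hab) (h hcd)⟩

theorem cliqueFree_five (hG : IsWeaklyPlanar G) : G.CliqueFree 5 := by
  intro s hs
  obtain ⟨p, K, h1, h2⟩ := hG
  let f : Fin 5 ≃ s := (s.equivFinOfCardEq hs.card_eq).symm
  have adj : ∀ a b, a ≠ b → G.Adj (f a) (f b) := fun a b hab =>
    hs.isClique (f a).2 (f b).2 (fun h => hab (f.injective (Subtype.ext h)))
  have ne : ∀ a b, a ≠ b → (f a : V) ≠ f b := fun a b hab => (adj a b hab).ne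
  have ex : ∀ a b, ∃ γ : ℝ → ℂ, a ≠ b → Continuous γ ∧ γ 0 = p (f a) ∧ γ 1 = p (f b) ∧
      ∀ t, γ t ∈ K (f a) (f b) := by
    intro a b
    by_cases hab : a = b
    · exact ⟨0, fun h => absurd hab h⟩
    · have J := h1 _ _ (adj a b hab)
      refine ⟨J.somePath.extend, fun _ => ⟨J.somePath.continuous_extend, by simp, by simp, ?_⟩⟩
      intro t
      exact J.somePath_mem _
  choose γ hγ using ex
  refine not_disjoint_curves_five (fun a => p (f a)) γ (fun a b h => (hγ a b h).1)
    (fun a b h => (hγ a b h).2.1) (fun a b h => (hγ a b h).2.2.1) ?_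
  intro a b c d hab hcd hac had hbc hbd s t heq
  exact Set.disjoint_left.1 (h2 _ _ _ _ (adj a b hab) (adj c d hcd) (ne _ _ hac) (ne _ _ had)
    (ne _ _ hbc) (ne _ _ hbd)) ((hγ a b hab).2.2.2 s) (heq ▸ (hγ c d hcd).2.2.2 t)

end IsWeaklyPlanar

namespace SimpleGraph

variable {V : Type*} (G : SimpleGraph V)

/-- The graph in which the vertex `v` is merged into `u`. -/
def mergeVertex (u v : V) : SimpleGraph V where
  Adj x y := (G.Adj x y ∧ x ≠ v ∧ y ≠ v) ∨ (x = u ∧ y ≠ u ∧ y ≠ v ∧ u ≠ v ∧ G.Adj v y) ∨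
    (y = u ∧ x ≠ u ∧ x ≠ v ∧ u ≠ v ∧ G.Adj x v)
  symm := ⟨by
    rintro x y (h | h | h)
    · exact .inl ⟨h.1.symm, h.2.2, h.2.1⟩
    · exact .inr (.inr ⟨h.1, h.2.1, h.2.2.1, h.2.2.2.1, h.2.2.2.2.symm⟩)
    · exact .inr (.inl ⟨h.1, h.2.1, h.2.2.1, h.2.2.2.1, h.2.2.2.2.symm⟩)⟩
  loopless := ⟨by
    rintro x (h | h | h)
    · exact h.1.ne rfl
    · exact h.2.1 h.1
    · exact h.2.1 h.1⟩

variable {G}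

theorem mergeVertex_ne {u v x y : V} (h : (G.mergeVertex u v).Adj x y) : x ≠ v ∧ y ≠ v := by
  rcases h with h | h | h
  · exact h.2
  · exact ⟨h.1 ▸ h.2.2.2.1, h.2.2.1⟩
  · exact ⟨h.2.2.1, h.1 ▸ h.2.2.2.1⟩

theorem mergeVertex_of_not_adj {u v x y : V} (huv : G.Adj u v) (h : (G.mergeVertex u v).Adj x y)
    (hxy : ¬ G.Adj x y) : G.Adj x v ∧ G.Adj v y ∧ (x = u ∨ y = u) := by
  rcases h with h | h | h
  · exact absurd h.1 hxy
  · exact ⟨h.1 ▸ huv, h.2.2.2.2, .inl h.1⟩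
  · exact ⟨h.2.2.2.2, h.1 ▸ huv.symm, .inr h.1⟩

end SimpleGraph

/-- A new edge at u is drawn along uv and then on from v. Of two edges without a common end at most
one is new, and the other avoids v, so it is disjoint from both pieces. -/
theorem IsWeaklyPlanar.mergeVertex {V : Type*} {G : SimpleGraph V} (hG : IsWeaklyPlanar G)
    {u v : V} (huv : G.Adj u v) : IsWeaklyPlanar (G.mergeVertex u v) := by
  classical
  obtain ⟨p, K, h1, h2⟩ := hG
  refine ⟨p, fun x y => if G.Adj x y then K x y else K x v ∪ K v y, fun a b hab => ?_,
    fun a b c d hab hcd hac had hbc hbd => ?_⟩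
  · beta_reduce
    split_ifs with h
    · exact h1 a b h
    · obtain ⟨hav, hvb, -⟩ := SimpleGraph.mergeVertex_of_not_adj huv hab h
      exact ((h1 a v hav).mono Set.subset_union_left).trans
        ((h1 v b hvb).mono Set.subset_union_right)
  · have hne := SimpleGraph.mergeVertex_ne hab
    have hne' := SimpleGraph.mergeVertex_ne hcd
    beta_reduce
    split_ifs with h h' h'
    · exact h2 a b c d h h' hac had hbc hbd
    · obtain ⟨hcv, hvd, -⟩ := SimpleGraph.mergeVertex_of_not_adj huv hcd h'
      exact Set.disjoint_union_right.2 ⟨h2 a b c v h hcv hac hne.1 hbc hne.2,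
        h2 a b v d h hvd hne.1 had hne.2 hbd⟩
    · obtain ⟨hav, hvb, -⟩ := SimpleGraph.mergeVertex_of_not_adj huv hab h
      exact Set.disjoint_union_left.2 ⟨h2 a v c d hav h' hac had hne'.1.symm hne'.2.symm,
        h2 v b c d hvb h' hne'.1.symm hne'.2.symm hbc hbd⟩
    · obtain ⟨-, -, h3⟩ := SimpleGraph.mergeVertex_of_not_adj huv hab h
      obtain ⟨-, -, h4⟩ := SimpleGraph.mergeVertex_of_not_adj huv hcd h'
      rcases h3 with rfl | rfl <;> rcases h4 with rfl | rfl <;> contradiction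

namespace SimpleGraph

variable {V : Type*} [Fintype V] [DecidableEq V] (G : SimpleGraph V) [DecidableRel G.Adj]

/-- Contraction loses only the edge uv and one edge for each common neighbour, where two edges
coincide. -/
theorem card_edgeFinset_le_mergeVertex {u v : V} (huv : G.Adj u v)
    [DecidableRel (G.mergeVertex u v).Adj] :
    G.edgeFinset.card ≤ (G.mergeVertex u v).edgeFinset.card + 1 +
      (G.neighborFinset u ∩ G.neighborFinset v).card := by
  set W := G.neighborFinset v \ insert u (G.neighborFinset u) with hW
  have hsub : (G.deleteIncidenceSet v).edgeFinset ∪ W.image (fun w => s(u, w)) ⊆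
      (G.mergeVertex u v).edgeFinset := by
    intro e he
    rw [Finset.mem_union] at he
    rw [mem_edgeFinset]
    rcases he with he | he
    · induction e with | _ x y =>
      rw [mem_edgeFinset, mem_edgeSet, deleteIncidenceSet_adj] at he
      exact .inl he
    · obtain ⟨w, hw, rfl⟩ := Finset.mem_image.1 he
      simp only [hW, Finset.mem_sdiff, Finset.mem_insert, mem_neighborFinset, not_or] at hw
      exact .inr (.inl ⟨rfl, hw.2.1, hw.1.ne', huv.ne, hw.1⟩)
  have hdisj : Disjoint (G.deleteIncidenceSet v).edgeFinset (W.image (fun w => s(u, w))) := by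
    rw [Finset.disjoint_right]
    intro e he he'
    obtain ⟨w, hw, rfl⟩ := Finset.mem_image.1 he
    simp only [hW, Finset.mem_sdiff, Finset.mem_insert, mem_neighborFinset, not_or] at hw
    rw [mem_edgeFinset, mem_edgeSet, deleteIncidenceSet_adj] at he'
    exact hw.2.2 he'.1
  have hcard := Finset.card_le_card hsub
  rw [Finset.card_union_of_disjoint hdisj, card_edgeFinset_deleteIncidenceSet,
    Finset.card_image_of_injective _ (fun x y h => Sym2.congr_right.1 h)] at hcard
  have h1 : (G.neighborFinset v).card ≤ W.card +
      (insert u (G.neighborFinset u ∩ G.neighborFinset v)).card := by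
    refine (Finset.card_le_card ?_).trans (Finset.card_union_le _ _)
    intro w hw
    simp only [hW, Finset.mem_union, Finset.mem_sdiff, Finset.mem_insert, Finset.mem_inter]
    tauto
  have h2 := Finset.card_insert_le u (G.neighborFinset u ∩ G.neighborFinset v)
  rw [card_neighborFinset_eq_degree] at h1
  omega

end SimpleGraph

/-! ### Mader's edge bound -/

namespace IsWeaklyPlanar

open SimpleGraph

variable {V : Type*} [DecidableEq V] {G : SimpleGraph V}

theorem not_four_clique_of_adj (hG : IsWeaklyPlanar G) {x : V} {t : Finset V}
    (ht : G.IsNClique 4 t) (hx : ∀ y ∈ t, G.Adj x y) : False :=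
  hG.cliqueFree_five _ (ht.insert hx)

/-- A vertex of degree five in a weakly planar graph has a neighbour that is not joined to two
other neighbours. -/
theorem exists_two_nonadjacent (hG : IsWeaklyPlanar G) {x : V} {t : Finset V} (ht : t.card = 5)
    (hx : ∀ y ∈ t, G.Adj x y) :
    ∃ y ∈ t, ∃ z ∈ t, ∃ w ∈ t, y ≠ z ∧ y ≠ w ∧ z ≠ w ∧ ¬ G.Adj y z ∧ ¬ G.Adj y w := by
  by_contra! hcon
  by_cases hcl : ∃ a ∈ t, ∃ b ∈ t, a ≠ b ∧ ¬ G.Adj a b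
  · obtain ⟨a, ha, b, hb, hab, nab⟩ := hcl
    have hna : ∀ y ∈ t, y ≠ a → y ≠ b → G.Adj a y := fun y hy hya hyb =>
      hcon a ha b hb y hy hab hya.symm hyb.symm nab
    have hnb : ∀ y ∈ t, y ≠ a → y ≠ b → G.Adj b y := fun y hy hya hyb =>
      hcon b hb a ha y hy hab.symm hyb.symm hya.symm (fun h => nab h.symm)
    -- Non-adjacency on t is a matching, so on five vertices it has at most one pair besides ab.
    -- With c in that pair, if it exists, merging c into a supplies the edge ab and removes the
    -- other defect: t without c becomes a 4-clique joined to x.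
    obtain ⟨c, hct, hca, hcb, hc⟩ : ∃ c ∈ t, c ≠ a ∧ c ≠ b ∧ ∀ y ∈ t, ∀ z ∈ t, y ≠ z →
        y ≠ a → y ≠ b → y ≠ c → z ≠ a → z ≠ b → z ≠ c → G.Adj y z := by
      by_cases h2 : ∃ c ∈ t, ∃ d ∈ t, c ≠ d ∧ c ≠ a ∧ c ≠ b ∧ d ≠ a ∧ d ≠ b ∧ ¬ G.Adj c d
      · obtain ⟨c, hc, d, hd, hcd, hca, hcb, hda, hdb, ncd⟩ := h2
        refine ⟨c, hc, hca, hcb, fun y hy z hz hyz hya hyb hyc hza hzb hzc => ?_⟩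
        by_contra nyz
        by_cases hyd : y = d
        · subst hyd
          exact nyz (hcon y hd c hc z hz hcd.symm hyz hzc.symm (fun h => ncd h.symm))
        · by_cases hzd : z = d
          · subst hzd
            exact nyz (hcon z hd c hc y hy hcd.symm hyz.symm hyc.symm (fun h => ncd h.symm)).symm
          · have : ({a, b, c, d, y, z} : Finset V).card ≤ t.card := by
              apply Finset.card_le_card
              intro w hw
              simp only [Finset.mem_insert, Finset.mem_singleton] at hw
              rcases hw with rfl | rfl | rfl | rfl | rfl | rfl <;> assumption
            have h6 : ({a, b, c, d, y, z} : Finset V).card = 6 := by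
              rw [Finset.card_insert_of_notMem, Finset.card_insert_of_notMem,
                Finset.card_insert_of_notMem, Finset.card_insert_of_notMem,
                Finset.card_insert_of_notMem, Finset.card_singleton] <;>
              simp only [Finset.mem_insert, Finset.mem_singleton, not_or] <;>
              tauto
            omega
      · push Not at h2
        obtain ⟨c, hc⟩ : ((t.erase a).erase b).Nonempty := by
          rw [← Finset.card_pos, Finset.card_erase_of_mem (by simp [hb, hab.symm]),
            Finset.card_erase_of_mem ha]
          omega
        simp only [Finset.mem_erase] at hc
        exact ⟨c, hc.2.2, hc.2.1, hc.1, fun y hy z hz hyz hya hyb _ hza hzb _ =>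
          h2 y hy z hz hyz hya hyb hza hzb⟩
    have hac := hna c hct hca hcb
    have hbc := hnb c hct hca hcb
    have hadj : ∀ y ∈ t.erase c, ∀ z ∈ t.erase c, y ≠ z → (G.mergeVertex a c).Adj y z := by
      intro y hy z hz hyz
      simp only [Finset.mem_erase] at hy hz
      by_cases hyz' : G.Adj y z
      · exact .inl ⟨hyz', hy.1, hz.1⟩
      · have : (y = a ∧ z = b) ∨ (y = b ∧ z = a) := by
          by_contra hno
          apply hyz'
          by_cases hya : y = a
          · subst hya
            exact hna z hz.2 hyz.symm (by tauto)
          by_cases hyb : y = b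
          · subst hyb
            exact hnb z hz.2 (by tauto) hyz.symm
          by_cases hza : z = a
          · subst hza
            exact (hna y hy.2 hya hyb).symm
          by_cases hzb : z = b
          · subst hzb
            exact (hnb y hy.2 hya hyb).symm
          exact hc y hy.2 z hz.2 hyz hya hyb hy.1 hza hzb hz.1
        rcases this with ⟨rfl, rfl⟩ | ⟨rfl, rfl⟩
        · exact .inr (.inl ⟨rfl, hyz.symm, hz.1, hy.1, hbc.symm⟩)
        · exact .inr (.inr ⟨rfl, hyz, hy.1, hz.1, hbc⟩)
    refine (hG.mergeVertex hac).not_four_clique_of_adj (x := x) (t := t.erase c)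
      ⟨fun y hy z hz => hadj y hy z hz, by rw [Finset.card_erase_of_mem hct, ht]⟩ ?_
    intro y hy
    rw [Finset.mem_erase] at hy
    exact .inl ⟨hx y hy.2, (hx c hct).ne, hy.1⟩
  · push Not at hcl
    obtain ⟨a, ha⟩ : t.Nonempty := by rw [← Finset.card_pos]; omega
    refine hG.not_four_clique_of_adj (x := x) (t := t.erase a)
      ⟨fun y hy z hz hyz => ?_, by rw [Finset.card_erase_of_mem ha, ht]⟩
      (fun y hy => hx y (Finset.mem_of_mem_erase hy))
    exact hcl y (Finset.mem_of_mem_erase hy) z (Finset.mem_of_mem_erase hz) hyz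

end IsWeaklyPlanar

open SimpleGraph in
/-- Every nonempty set of vertices that supports a weakly planar graph satisfies the linear edge
bound; this is Mader's argument for graphs without a complete minor on five vertices. -/
theorem IsWeaklyPlanar.card_edgeFinset_add_three_le {V : Type*} [Fintype V] [DecidableEq V]
    {G : SimpleGraph V} [DecidableRel G.Adj] (hG : IsWeaklyPlanar G) {s : Finset V}
    (hs : s.Nonempty) (hsup : ∀ a b, G.Adj a b → a ∈ s) :
    G.edgeFinset.card + 3 ≤ 3 * s.card := by
  classical
  induction hn : s.card using Nat.strong_induction_on generalizing s G with
  | _ n ih =>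
  by_contra! hlt
  have hn1 : 1 ≤ n := hn ▸ hs.card_pos
  -- Exactly 3n - 2 edges are kept, so that the degree sum 6n - 4 stays below 6n.
  obtain ⟨F, hF, hFcard⟩ := Finset.exists_subset_card_eq
    (show 3 * n - 2 ≤ G.edgeFinset.card by omega)
  obtain ⟨H, hHG, hHF⟩ : ∃ H : SimpleGraph V, H ≤ G ∧ H.edgeSet = F := by
    refine ⟨fromEdgeSet (F : Set (Sym2 V)), ?_, ?_⟩
    · intro a b hab
      rw [fromEdgeSet_adj] at hab
      exact mem_edgeFinset.1 (hF hab.1)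
    · rw [edgeSet_fromEdgeSet]
      ext e
      refine ⟨fun h => h.1, fun h => ⟨h, fun hd => ?_⟩⟩
      exact G.not_isDiag_of_mem_edgeSet (mem_edgeFinset.1 (hF h)) hd
  have hH : H.edgeFinset.card = 3 * n - 2 := by
    rw [← hFcard]
    congr 1
    ext e
    rw [mem_edgeFinset, hHF, Finset.mem_coe]
  have hHW := hG.mono hHG
  have hHsup : ∀ a b, H.Adj a b → a ∈ s := fun a b hab => hsup a b (hHG hab)
  -- Otherwise contraction loses at most 3 edges and leaves 3n - 5, too many for n - 1 vertices. The
  -- vertex v stays behind isolated, so it is the support s that shrinks.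
  have hcommon : ∀ u v, H.Adj u v → 3 ≤ (H.neighborFinset u ∩ H.neighborFinset v).card := by
    intro u v huv
    by_contra! hc
    have h1 := H.card_edgeFinset_le_mergeVertex huv
    have hv := hHsup v u huv.symm
    have h2 := ih (n - 1) (by omega) (hHW.mergeVertex huv) (s := s.erase v)
      ⟨u, Finset.mem_erase.2 ⟨huv.ne, hHsup u v huv⟩⟩ (fun a b hab => by
        refine Finset.mem_erase.2 ⟨(mergeVertex_ne hab).1, ?_⟩
        rcases hab with h | h | h
        · exact hHsup a b h.1
        · exact h.1 ▸ hHsup u v huv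
        · exact hHsup a v h.2.2.2.2) (by rw [Finset.card_erase_of_mem hv, hn])
    omega
  obtain ⟨x, hxs, hx⟩ : ∃ x ∈ s, H.degree x ≤ 5 := by
    by_contra! hdeg
    have h1 : ∑ x ∈ s, 6 ≤ ∑ x ∈ s, H.degree x := Finset.sum_le_sum fun x hx => hdeg x hx
    have h2 : ∑ x ∈ s, H.degree x ≤ ∑ x, H.degree x :=
      Finset.sum_le_sum_of_subset (Finset.subset_univ s)
    rw [sum_degrees_eq_twice_card_edges, hH] at h2
    rw [Finset.sum_const, smul_eq_mul, hn] at h1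
    omega
  have hsubset : ∀ y, H.neighborFinset x ∩ H.neighborFinset y ⊆ (H.neighborFinset x).erase y := by
    intro y z hz
    simp only [Finset.mem_inter, mem_neighborFinset] at hz
    exact Finset.mem_erase.2 ⟨hz.2.ne', (mem_neighborFinset ..).2 hz.1⟩
  have hdpos : 0 < H.degree x := by
    by_contra! h0
    have hno : ∀ b, ¬ H.Adj x b := by
      intro b hb
      have : 0 < H.degree x := (H.degree_pos_iff_exists_adj x).2 ⟨b, hb⟩
      omega
    have hax : ∀ a b, H.Adj a b → a ∈ s.erase x := fun a b hab =>
      Finset.mem_erase.2 ⟨fun h => hno b (h ▸ hab), hHsup a b hab⟩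
    obtain ⟨e, he⟩ : H.edgeFinset.Nonempty := by rw [← Finset.card_pos]; omega
    induction e with | _ a b =>
    rw [mem_edgeFinset, mem_edgeSet] at he
    have := ih (n - 1) (by omega) hHW (s := s.erase x) ⟨a, hax a b he⟩ hax
      (by rw [Finset.card_erase_of_mem hxs, hn])
    omega
  have hadj : ∀ y ∈ H.neighborFinset x, H.Adj x y := fun y hy => (mem_neighborFinset ..).1 hy
  have hd4 : 4 ≤ H.degree x := by
    obtain ⟨y, hy⟩ := (H.degree_pos_iff_exists_adj x).1 hdpos
    have h1 := (hcommon x y hy).trans (Finset.card_le_card (hsubset y))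
    rw [Finset.card_erase_of_mem ((mem_neighborFinset ..).2 hy), card_neighborFinset_eq_degree]
      at h1
    omega
  obtain h4 | h5 : H.degree x = 4 ∨ H.degree x = 5 := by omega
  · refine hHW.not_four_clique_of_adj (x := x) (t := H.neighborFinset x) ⟨?_, h4⟩ hadj
    intro y hy z hz hyz
    have heq := Finset.eq_of_subset_of_card_le (hsubset y) (by
      rw [Finset.card_erase_of_mem hy, card_neighborFinset_eq_degree, h4]
      exact hcommon x y (hadj y hy))
    have : z ∈ (H.neighborFinset x).erase y := Finset.mem_erase.2 ⟨hyz.symm, hz⟩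
    rw [← heq, Finset.mem_inter] at this
    exact (mem_neighborFinset ..).1 this.2
  -- Two non-neighbours among the other four leave y at most two common neighbours with x.
  · obtain ⟨y, hy, z, hz, w, hw, hyz, hyw, hzw, nyz, nyw⟩ :=
      hHW.exists_two_nonadjacent (t := H.neighborFinset x) h5 hadj
    have hsub : H.neighborFinset x ∩ H.neighborFinset y ⊆
        (((H.neighborFinset x).erase y).erase z).erase w := by
      intro v hv
      have hv' := hsubset y hv
      rw [Finset.mem_inter, mem_neighborFinset, mem_neighborFinset] at hv
      refine Finset.mem_erase.2 ⟨?_, Finset.mem_erase.2 ⟨?_, hv'⟩⟩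
      · rintro rfl; exact nyw hv.2
      · rintro rfl; exact nyz hv.2
    have h1 := (hcommon x y (hadj y hy)).trans (Finset.card_le_card hsub)
    rw [Finset.card_erase_of_mem (by simp only [Finset.mem_erase]; tauto),
      Finset.card_erase_of_mem (by simp only [Finset.mem_erase]; tauto),
      Finset.card_erase_of_mem hy, card_neighborFinset_eq_degree, h5] at h1
    omega

/-! ### Counting small cliques -/

namespace SimpleGraph

variable {V : Type*} [Fintype V] [DecidableEq V]

theorem card_pairs_le_card_edgeFinset (H : SimpleGraph V) [DecidableRel H.Adj]
    {T : Finset (Finset V)} (hcard : ∀ t ∈ T, t.card = 2)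
    (hadj : ∀ t ∈ T, ∀ a ∈ t, ∀ b ∈ t, a ≠ b → H.Adj a b) : T.card ≤ H.edgeFinset.card := by
  refine (Finset.card_le_card (t := H.edgeFinset.image Sym2.toFinset) ?_).trans
    Finset.card_image_le
  intro t ht
  obtain ⟨a, b, hab, rfl⟩ := Finset.card_eq_two.1 (hcard t ht)
  exact Finset.mem_image.2 ⟨s(a, b),
    mem_edgeFinset.2 (hadj _ ht a (by simp) b (by simp) hab), Sym2.toFinset_mk_eq⟩

end SimpleGraph

namespace IsWeaklyPlanar

open SimpleGraph

variable {V : Type*} [Fintype V] [DecidableEq V] {H : SimpleGraph V} [DecidableRel H.Adj]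

/-- With d the degree of v, the closed neighbourhood spans at most 3(d + 1) - 3 = 3d edges. Of these
d meet v, and triangles at v correspond to edges among the rest. -/
theorem card_triangles_at_le (hH : IsWeaklyPlanar H) (v : V)
    {T : Finset (Finset V)} (hcard : ∀ t ∈ T, t.card = 3) (hv : ∀ t ∈ T, v ∈ t)
    (hadj : ∀ t ∈ T, ∀ a ∈ t, ∀ b ∈ t, a ≠ b → H.Adj a b) : T.card ≤ 2 * H.degree v := by
  classical
  set s := insert v (H.neighborFinset v) with hs
  let J : SimpleGraph V :=
    { Adj := fun a b => H.Adj a b ∧ a ∈ s ∧ b ∈ s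
      symm := ⟨fun a b h => ⟨h.1.symm, h.2.2, h.2.1⟩⟩
      loopless := ⟨fun a h => h.1.ne rfl⟩ }
  have hJ : IsWeaklyPlanar J := hH.mono fun a b h => h.1
  have h1 := hJ.card_edgeFinset_add_three_le (s := s) ⟨v, Finset.mem_insert_self ..⟩
    (fun a b h => h.2.1)
  have h2 : s.card ≤ H.degree v + 1 := Finset.card_insert_le ..
  have h3 : H.degree v ≤ J.degree v := by
    refine Finset.card_le_card fun w hw => ?_
    rw [mem_neighborFinset] at hw ⊢
    exact ⟨hw, by simp [hs], by simp [hs, hw]⟩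
  have h4 : (T.image fun t => t.erase v).card = T.card := by
    refine Finset.card_image_of_injOn fun t ht t' ht' h => ?_
    rw [← Finset.insert_erase (hv t ht), ← Finset.insert_erase (hv t' ht')]
    exact congrArg (insert v) h
  have h5 := (J.deleteIncidenceSet v).card_pairs_le_card_edgeFinset
    (T := T.image fun t => t.erase v) (by
      intro _ ht'
      obtain ⟨t, ht, rfl⟩ := Finset.mem_image.1 ht'
      rw [Finset.card_erase_of_mem (hv t ht), hcard t ht]) (by
      intro _ ht' a ha b hb hab
      obtain ⟨t, ht, rfl⟩ := Finset.mem_image.1 ht'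
      rw [Finset.mem_erase] at ha hb
      have mem : ∀ x ∈ t, x ≠ v → x ∈ s := fun x hx hxv =>
        Finset.mem_insert_of_mem ((mem_neighborFinset ..).2 (hadj t ht v (hv t ht) x hx hxv.symm))
      exact deleteIncidenceSet_adj.2 ⟨⟨hadj t ht a ha.2 b hb.2 hab, mem a ha.2 ha.1,
        mem b hb.2 hb.1⟩, ha.1, hb.1⟩)
  rw [h4, card_edgeFinset_deleteIncidenceSet] at h5
  omega

theorem card_cliques_lt (hH : IsWeaklyPlanar H) [Nonempty V] {T : Finset (Finset V)}
    (hne : ∀ t ∈ T, t.Nonempty) (hcard : ∀ t ∈ T, t.card ≤ 3)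
    (hadj : ∀ t ∈ T, ∀ a ∈ t, ∀ b ∈ t, a ≠ b → H.Adj a b) : T.card < 8 * Fintype.card V := by
  have hedge := hH.card_edgeFinset_add_three_le (s := Finset.univ) Finset.univ_nonempty
    (fun a b _ => Finset.mem_univ a)
  rw [Finset.card_univ] at hedge
  set T₃ := T.filter fun t => t.card = 3 with hT₃
  have hsplit : T ⊆ {t ∈ T | t.card = 1} ∪ ({t ∈ T | t.card = 2} ∪ T₃) := by
    intro t ht
    have h1 := (hne t ht).card_pos
    have h2 := hcard t ht
    simp only [hT₃, Finset.mem_union, Finset.mem_filter, ht, true_and]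
    omega
  have hT := (Finset.card_le_card hsplit).trans ((Finset.card_union_le _ _).trans
    (Nat.add_le_add_left (Finset.card_union_le _ _) _))
  have hone : (T.filter fun t => t.card = 1).card ≤ Fintype.card V := by
    refine (Finset.card_le_card (t := Finset.univ.image fun a : V => ({a} : Finset V)) ?_).trans
      Finset.card_image_le
    intro t ht
    obtain ⟨a, rfl⟩ := Finset.card_eq_one.1 (Finset.mem_filter.1 ht).2
    exact Finset.mem_image_of_mem _ (Finset.mem_univ a)
  have htwo := H.card_pairs_le_card_edgeFinset (T := T.filter fun t => t.card = 2)
    (fun t ht => (Finset.mem_filter.1 ht).2) (fun t ht => hadj t (Finset.mem_filter.1 ht).1)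
  -- Count triangles by their corners: each has three, and the degrees sum to twice the number of
  -- edges.
  have hthree : 3 * T₃.card ≤ 4 * H.edgeFinset.card := by
    have h1 : ∑ v, (T₃.filter fun t => v ∈ t).card ≤ ∑ v, 2 * H.degree v := by
      refine Finset.sum_le_sum fun v _ => hH.card_triangles_at_le v ?_ ?_ ?_
      · exact fun t ht => (Finset.mem_filter.1 (Finset.mem_filter.1 ht).1).2
      · exact fun t ht => (Finset.mem_filter.1 ht).2
      · exact fun t ht => hadj t (Finset.mem_filter.1 (Finset.mem_filter.1 ht).1).1
    have h2 : ∑ v, (T₃.filter fun t => v ∈ t).card = ∑ t ∈ T₃, t.card := by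
      have := Finset.sum_card_bipartiteAbove_eq_sum_card_bipartiteBelow
        (s := (Finset.univ : Finset V)) (t := T₃) (fun v t => v ∈ t)
      simpa [Finset.bipartiteAbove, Finset.bipartiteBelow] using this
    rw [h2, Finset.sum_const_nat (s := T₃) (m := 3) (fun t ht => (Finset.mem_filter.1 ht).2),
      ← Finset.mul_sum, H.sum_degrees_eq_twice_card_edges] at h1
    omega
  omega

end IsWeaklyPlanar

/-! ### From the Tanner graph to its shadow -/

namespace PlaneEmbedding

variable {V : Type*} {G : SimpleGraph V} (D : PlaneEmbedding G)

theorem joinedIn_range_arc {x y : V} (h : G.Adj x y) :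
    JoinedIn (Set.range (D.arc ⟨s(x, y), h⟩)) (D.point x) (D.point y) := by
  have hends := D.arc_ends ⟨s(x, y), h⟩
  have J : JoinedIn (Set.range (D.arc ⟨s(x, y), h⟩)) (D.arc ⟨s(x, y), h⟩ 0)
      (D.arc ⟨s(x, y), h⟩ 1) :=
    ⟨⟨⟨_, D.arc_continuous _⟩, rfl, rfl⟩, fun t => Set.mem_range_self t⟩
  rw [Sym2.map_mk, Sym2.eq_iff] at hends
  rcases hends with ⟨h0, h1⟩ | ⟨h0, h1⟩
  · rwa [h0, h1] at J
  · rw [h0, h1] at J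
    exact J.symm

theorem eq_or_eq_of_arc_eq_point {x y z : V} (h : G.Adj x y) {t : unitInterval}
    (ht : D.arc ⟨s(x, y), h⟩ t = D.point z) : z = x ∨ z = y := by
  have hends := D.arc_ends ⟨s(x, y), h⟩
  rw [Sym2.map_mk, Sym2.eq_iff] at hends
  have hpoint : D.point z = D.point x ∨ D.point z = D.point y := by
    by_cases h0 : t = 0
    · rw [← ht, h0]
      exact hends.imp (fun h => h.1) (fun h => h.1)
    by_cases h1 : t = 1
    · rw [← ht, h1]
      exact (hends.imp (fun h => h.2) (fun h => h.2)).symm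
    exact absurd ⟨z, ht.symm⟩ (D.arc_interior _ t h0 h1)
  exact hpoint.imp (fun h => D.point_injective h) (fun h => D.point_injective h)

theorem disjoint_range_arc {x y z w : V} (h : G.Adj x y) (h' : G.Adj z w) (hxz : x ≠ z)
    (hxw : x ≠ w) (hyz : y ≠ z) (hyw : y ≠ w) :
    Disjoint (Set.range (D.arc ⟨s(x, y), h⟩)) (Set.range (D.arc ⟨s(z, w), h'⟩)) := by
  rw [Set.disjoint_left]
  rintro _ ⟨t, rfl⟩ ⟨t', ht'⟩
  have hne : (⟨s(x, y), h⟩ : G.edgeSet) ≠ ⟨s(z, w), h'⟩ := by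
    intro heq
    have := Subtype.ext_iff.1 heq
    rw [Sym2.eq_iff] at this
    tauto
  obtain ⟨a, ha⟩ := D.arc_inter _ _ hne t t' ht'.symm
  rcases D.eq_or_eq_of_arc_eq_point h ha.symm with rfl | rfl <;>
  rcases D.eq_or_eq_of_arc_eq_point h' (ht'.trans ha.symm) with rfl | rfl <;>
  contradiction

end PlaneEmbedding

namespace TannerGraph

variable {B C : Type*} (G : TannerGraph B C)

/-- The graph on the check nodes in which two of them are joined if they share a bit node. -/
def shadow : SimpleGraph C where
  Adj c d := c ≠ d ∧ ∃ b, G.Adj b c ∧ G.Adj b d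
  symm := ⟨fun _ _ h => ⟨h.1.symm, h.2.imp fun _ hb => hb.symm⟩⟩
  loopless := ⟨fun _ h => h.1 rfl⟩

variable {G}

theorem mem_bitNeighbors [Fintype C] {b : B} {c : C} : c ∈ G.bitNeighbors b ↔ G.Adj b c := by
  simp [bitNeighbors]

theorem isWeaklyPlanar_shadow [Fintype C] (hG : G.IsPlanar) (hdeg : ∀ b, G.bitDegree b ≤ 3) :
    IsWeaklyPlanar G.shadow := by
  classical
  obtain ⟨D⟩ := hG
  let e := Complex.orthonormalBasisOneI.repr.symm
  have he : Continuous e := e.continuous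
  have ex : ∀ c d, ∃ S : Set ℂ, G.shadow.Adj c d → ∃ b, ∃ (h₁ : G.Adj b c) (h₂ : G.Adj b d),
      S = e '' (Set.range (D.arc ⟨s(.inl b, .inr c), h₁⟩) ∪
        Set.range (D.arc ⟨s(.inl b, .inr d), h₂⟩)) := by
    intro c d
    by_cases h : G.shadow.Adj c d
    · obtain ⟨-, b, h₁, h₂⟩ := h
      exact ⟨_, fun _ => ⟨b, h₁, h₂, rfl⟩⟩
    · exact ⟨∅, fun h' => absurd h' h⟩
  choose K hK using ex
  refine ⟨fun c => e (D.point (.inr c)), K, fun c d hcd => ?_,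
    fun c d c' d' hcd hcd' h1 h2 h3 h4 => ?_⟩
  · obtain ⟨b, h₁, h₂, hS⟩ := hK c d hcd
    rw [hS]
    have J₁ := D.joinedIn_range_arc (x := .inl b) (y := .inr c) h₁
    have J₂ := D.joinedIn_range_arc (x := .inl b) (y := .inr d) h₂
    exact ((J₁.symm.mono Set.subset_union_left).trans (J₂.mono Set.subset_union_right)).map he
  · obtain ⟨b, hc, hd, hS⟩ := hK c d hcd
    obtain ⟨b', hc', hd', hS'⟩ := hK c' d' hcd'
    have hbb : b ≠ b' := by
      rintro rfl
      have hsub : ({c, d, c', d'} : Finset C) ⊆ G.bitNeighbors b := by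
        intro x hx
        simp only [Finset.mem_insert, Finset.mem_singleton] at hx
        rw [mem_bitNeighbors]
        rcases hx with rfl | rfl | rfl | rfl <;> assumption
      have := (Finset.card_le_card hsub).trans (hdeg b)
      have hcd0 := hcd.1
      have hcd0' := hcd'.1
      simp [*] at this
    have dis : ∀ x y, ∀ (hx : G.Adj b x) (hy : G.Adj b' y), x ≠ y →
        Disjoint (Set.range (D.arc ⟨s(.inl b, .inr x), hx⟩))
          (Set.range (D.arc ⟨s(.inl b', .inr y), hy⟩)) := fun x y hx hy hxy =>
      D.disjoint_range_arc (x := .inl b) (y := .inr x) (z := .inl b') (w := .inr y) hx hy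
        (by simpa using hbb) (by simp) (by simp) (by simpa using hxy)
    rw [hS, hS', Set.disjoint_image_iff e.injective, Set.disjoint_union_left,
      Set.disjoint_union_right, Set.disjoint_union_right]
    exact ⟨⟨dis _ _ _ _ h1, dis _ _ _ _ h2⟩, dis _ _ _ _ h3, dis _ _ _ _ h4⟩

theorem exists_bitNeighbors_eq [Fintype B] [Fintype C] (hG : G.IsPlanar)
    (hdeg : ∀ b, G.bitDegree b ≤ 3) (hB : 0 < Fintype.card B)
    (hcard : 8 * Fintype.card C ≤ Fintype.card B) (hne : ∀ b, (G.bitNeighbors b).Nonempty) :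
    ∃ b b', b ≠ b' ∧ G.bitNeighbors b = G.bitNeighbors b' := by
  classical
  by_contra! hcon
  obtain ⟨b⟩ : Nonempty B := Fintype.card_pos_iff.1 hB
  obtain ⟨c, -⟩ := hne b
  have : Nonempty C := ⟨c⟩
  have hinj : Function.Injective G.bitNeighbors := fun b b' h => by
    by_contra hbb
    exact hcon b b' hbb h
  have := (isWeaklyPlanar_shadow hG hdeg).card_cliques_lt
    (T := Finset.univ.image G.bitNeighbors) (by simpa using hne) (by simpa [bitDegree] using hdeg) (by
      intro t ht x hx y hy hxy
      obtain ⟨b, -, rfl⟩ := Finset.mem_image.1 ht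
      exact ⟨hxy, b, mem_bitNeighbors.1 hx, mem_bitNeighbors.1 hy⟩)
  rw [Finset.card_image_of_injective _ hinj, Finset.card_univ] at this
  omega

theorem mem_code_iff [Fintype B] {x : B → ZMod 2} :
    x ∈ G.code ↔ G.parityCheck.mulVec x = 0 := Iff.rfl

theorem parityCheck_apply [Fintype C] (b : B) (c : C) [Decidable (c ∈ G.bitNeighbors b)] :
    G.parityCheck c b = if c ∈ G.bitNeighbors b then 1 else 0 := by
  by_cases h : G.Adj b c
  · rw [if_pos (mem_bitNeighbors.2 h)]
    simp [parityCheck, h]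
  · rw [if_neg (mt mem_bitNeighbors.1 h)]
    simp [parityCheck, h]

end TannerGraph

/-! ### Codewords of small weight -/

theorem hammingNorm_le_card {ι R : Type*} [Fintype ι] [Zero R] [DecidableEq R] {x : ι → R}
    (s : Finset ι) (hx : ∀ i ∉ s, x i = 0) : hammingNorm x ≤ s.card :=
  Finset.card_le_card fun i hi => by
    by_contra his
    exact (Finset.mem_filter.1 hi).2 (hx i his)

theorem codeMinDist_le {B : Type*} [Fintype B] {K : Submodule (ZMod 2) (B → ZMod 2)}
    {x : B → ZMod 2} (hx : x ∈ K) (hx0 : x ≠ 0) {n : ℕ} (hn : hammingNorm x ≤ n) :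
    codeMinDist K ≤ n := by
  refine (iInf₂_le_of_le x hx (iInf₂_le_of_le 0 K.zero_mem (iInf_le _ hx0))).trans ?_
  rw [hammingDist_zero_right]
  exact_mod_cast hn

/-- A planar Tanner graph with at least one bit node, bit-node degrees at most three and rate
`1 - m / n ≥ 7 / 8` defines a code of minimum distance at most three. -/
theorem proposition2 {B C : Type*} [Fintype B] [Fintype C] (G : TannerGraph B C)
    (hplanar : G.IsPlanar)
    (hdeg : ∀ b : B, G.bitDegree b ≤ 3)
    (hn : 0 < Fintype.card B)
    (hrate : (7 / 8 : ℝ) ≤ 1 - (Fintype.card C : ℝ) / (Fintype.card B : ℝ)) :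
    codeMinDist G.code ≤ 3 := by
  classical
  have hcard : 8 * Fintype.card C ≤ Fintype.card B := by
    have hB : (0 : ℝ) < Fintype.card B := by exact_mod_cast hn
    have h1 : (Fintype.card C : ℝ) / Fintype.card B ≤ 1 / 8 := by linarith
    rw [div_le_iff₀ hB] at h1
    have h2 : (8 * Fintype.card C : ℝ) ≤ Fintype.card B := by linarith
    exact_mod_cast h2
  by_cases hne : ∀ b, (G.bitNeighbors b).Nonempty
  · obtain ⟨b, b', hbb, heq⟩ := TannerGraph.exists_bitNeighbors_eq hplanar hdeg hn hcard hne
    refine codeMinDist_le (n := 3) (x := Pi.single b 1 + Pi.single b' 1) ?_ ?_ ?_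
    · rw [TannerGraph.mem_code_iff, Matrix.mulVec_add, Matrix.mulVec_single_one,
        Matrix.mulVec_single_one]
      ext c
      simp only [Pi.add_apply, Matrix.col_apply, TannerGraph.parityCheck_apply, heq, Pi.zero_apply]
      exact CharTwo.add_self_eq_zero _
    · intro h
      simpa [hbb] using congrFun h b
    · refine (hammingNorm_le_card {b, b'} fun i hi => ?_).trans (Finset.card_le_two.trans (by simp))
      simp only [Finset.mem_insert, Finset.mem_singleton, not_or] at hi
      simp [hi.1, hi.2]
  · push Not at hne
    obtain ⟨b, hb⟩ := hne
    refine codeMinDist_le (n := 3) (x := Pi.single b 1) ?_ ?_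
      ((hammingNorm_le_card {b} fun i hi => Pi.single_eq_of_ne (by simpa using hi) _).trans
        (by simp))
    · rw [TannerGraph.mem_code_iff, Matrix.mulVec_single_one]
      ext c
      simp [TannerGraph.parityCheck_apply, hb]
    · intro h
      simpa using congrFun h b
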